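/- All graphs are finite, simple and undirected. A graph $H$ is a depth-$s$ minor of a graph $G$ if there are pairwise disjoint connected subgraphs $(M_i)_{i\in V(H)}$ of $G$, each of radius at most $s$, such that for every edge $ij$ of $H$ some vertex of $M_i$ is adjacent in $G$ to some vertex of $M_j$. A class $\mathcal C$ of graphs has bounded expansion if there is a function $f\colon\mathbb N\to\mathbb N$ such that for all $s\in\mathbb N$ and all $G\in\mathcal C$, every depth-$s$ minor $H$ of $G$ has average degree $2|E(H)|/|V(H)|\le f(s)$. A distance-$r$ dominating set of $G$ is a set $D\subseteq V(G)$ such that every vertex of $G$ is at distance at most $r$ from some vertex of $D$; it is a $c$-approximation of a minimum one if $|D|\le c\,|D'|$ for every distance-$r$ dominating set $D'$ of $G$. In the $\mathsf{CONGEST}_{BC}$ model the vertices of the network $G$, with $n=|V(G)|$, run the same deterministic program. Each vertex initially knows $n$, its own identifier and the identifiers of its neighbours; identifiers are pairwise distinct and consist of $\lceil\log_2 n\rceil$ bits. In each synchronous round every vertex broadcasts one and the same message of $O(\log n)$ bits to all its neighbours, receives the messages of its neighbours together with the identifiers of their senders, and then updates its state; local computation is unrestricted and is not counted. At termination every vertex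 outputs whether it belongs to the computed set. **Theorem.** There is an absolute constant $K$ such that the following holds. Let $\mathcal C$ be a class of graphs of bounded expansion and let $r\in\mathbb N$. There are constants $c=c(r)$ and $B=B(r)$, depending only on $\mathcal C$ and $r$, and a distributed algorithm in the $\mathsf{CONGEST}_{BC}$ model with messages of at most $B\lceil\log_2 n\rceil$ bits that terminates after at most $K r^2\log n$ communication rounds on $n$-vertex networks, and that for every $G\in\mathcal C$ and every assignment of identifiers outputs a $c$-approximation of a minimum distance-$r$ dominating set of $G$. -/

import Mathlib

/-! ### Classes of bounded expansion -/

/-- `H` is a depth-`r` minor of `G`: there are pairwise disjoint connected subgraphs of `G`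
(branch sets) of radius at most `r`, indexed by the vertices of `H`, such that the branch sets of
adjacent vertices of `H` are joined by an edge of `G`. -/
def IsShallowMinor {V W : Type} (r : ℕ) (H : SimpleGraph W) (G : SimpleGraph V) : Prop :=
  ∃ M : W → G.Subgraph,
    (∀ i, (M i).Connected ∧ (M i).coe.radius ≤ (r : ℕ∞)) ∧
    (∀ i j, i ≠ j → Disjoint (M i).verts (M j).verts) ∧
    (∀ i j, H.Adj i j → ∃ u ∈ (M i).verts, ∃ v ∈ (M j).verts, G.Adj u v)

/-- The average degree `2 |E(H)| / |V(H)|` of a finite graph. -/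
noncomputable def averageDegree {W : Type} (H : SimpleGraph W) : ℚ :=
  2 * (H.edgeSet.ncard : ℚ) / (Nat.card W : ℚ)

/-- A class of graphs (only its finite members matter). -/
abbrev GraphClass : Type 1 := (V : Type) → SimpleGraph V → Prop

/-- A class `C` of finite graphs has bounded expansion if there is a function `f` such that every
depth-`r` minor of every member of `C` has average degree at most `f r`, for every `r`. -/
def BoundedExpansion (C : GraphClass) : Prop :=
  ∃ f : ℕ → ℕ, ∀ (r : ℕ) (V : Type) [Finite V] (G : SimpleGraph V), C V G →
    ∀ (W : Type) [Finite W] (H : SimpleGraph W), IsShallowMinor r H G → averageDegree H ≤ f r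

/-! ### Distance-`r` dominating sets -/

/-- Every vertex is at distance at most `r` from a vertex of `D` (`edist` is `⊤` between different
components). -/
def IsDistDominating {V : Type} (G : SimpleGraph V) (r : ℕ) (D : Finset V) : Prop :=
  ∀ v, ∃ u ∈ D, G.edist u v ≤ (r : ℕ∞)

/-- `D` is a `c`-approximation of a minimum distance-`r` dominating set of `G`. -/
def IsApproxMinDistDominating {V : Type} (G : SimpleGraph V) (r c : ℕ) (D : Finset V) : Prop :=
  IsDistDominating G r D ∧ ∀ D' : Finset V, IsDistDominating G r D' → D.card ≤ c * D'.card

/-! ### The broadcast CONGEST model -/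

/-- A deterministic distributed algorithm in the broadcast CONGEST model, for a vertex decision
problem. Every vertex runs the same program and knows the number `n` of vertices of the network.
Messages are bit strings of length at most `B * ⌈log₂ n⌉`. Local computation is
free; only communication rounds and message lengths are accounted for. -/
structure CongestBCAlgorithm (B : ℕ) where
  /-- The local states of a vertex. -/
  State : Type
  /-- `init n i N` is the initial state of a vertex with identifier `i` whose neighbours have the
  identifiers in `N`. -/
  init : (n : ℕ) → (i : ℕ) → (N : Finset ℕ) → State
  /-- The message that a vertex broadcasts to all its neighbours, given its state. -/
  send : (n : ℕ) → State → List Bool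
  /-- The new state, given the old one and the set of received messages, each paired with the
  identifier of its sender. -/
  receive : (n : ℕ) → State → Finset (ℕ × List Bool) → State
  /-- The number of communication rounds after which all vertices terminate. -/
  rounds : (n : ℕ) → ℕ
  /-- The output of a vertex at termination: does it belong to the computed set? -/
  output : (n : ℕ) → State → Bool
  /-- The bound on the message size. -/
  length_send_le : ∀ n s, (send n s).length ≤ B * Nat.clog 2 n

/-- An assignment of pairwise different identifiers of `⌈log₂ n⌉` bits to the `n` vertices. -/
def IsIdAssignment {V : Type} [Fintype V] (ident : V → ℕ) : Prop :=
  Function.Injective ident ∧ ∀ v, ident v < 2 ^ Nat.clog 2 (Fintype.card V)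

namespace CongestBCAlgorithm

open Classical in
/-- The state of every vertex of the network `G` with identifiers `ident` after `t` synchronous
communication rounds. -/
noncomputable def stateAfter {B : ℕ} (A : CongestBCAlgorithm B) {V : Type} [Fintype V]
    (G : SimpleGraph V) (ident : V → ℕ) : (t : ℕ) → V → A.State
  | 0, v => A.init (Fintype.card V) (ident v) ((Finset.univ.filter (G.Adj v)).image ident)
  | t + 1, v =>
      A.receive (Fintype.card V) (A.stateAfter G ident t v)
        ((Finset.univ.filter (G.Adj v)).image fun w =>
          (ident w, A.send (Fintype.card V) (A.stateAfter G ident t w)))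

/-- The set of vertices that output `true` at termination. -/
noncomputable def outputSet {B : ℕ} (A : CongestBCAlgorithm B) {V : Type} [Fintype V]
    (G : SimpleGraph V) (ident : V → ℕ) : Finset V :=
  Finset.univ.filter fun v =>
    A.output (Fintype.card V)
      (A.stateAfter G ident (A.rounds (Fintype.card V)) v) = true

end CongestBCAlgorithm

/-! The construction computes a layering of the vertices by peeling and lets every vertex elect the
largest key in its ball of radius `r`; identifiers break ties between layers. Put `k = 2 * r` and
let `d` bound the average degree of depth-`k` minors.

Peeling: a phase starts with a set `R` and removes those vertices that, for every `j < k`, have few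
connections of length at most `j + 1` to `R` with interior outside `R`. Removed vertices therefore
reach few vertices of any later `R` (`card_reach_remaining_le`). This makes the total number of
short connections linear in `R.card`: a maximal family with disjoint interiors is a shallow minor on
`R` (`card_le_of_disjoint_walks`), and every other connection meets an interior vertex of the
family, which sees only boundedly many ends (`sum_card_nbUnion_reach_le`). By averaging, at least
half of `R` is removed (`two_mul_card_remaining_succ_le`), so logarithmically many phases suffice.

Approximation: from every vertex, only boundedly many vertices are reachable by a walk of length at
most `2 * r` on which the target has the largest layer (`card_weakReach_le`). If `w` elects `v` and
`u` dominates `w`, then the walk from `u` through `w` to `v` stays in the ball around `w`, where `v`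
is maximal. Each `u` of a competing dominating set thus accounts for boundedly many elected vertices
(`isApprox_filter_mem_spread`).

Communication: connections to `R`, maximal keys and elected keys are all found by flooding. The
flooded sets have bounded size by the same estimates, so each one fits into a message
(`exists_encoding`, `peelRun_cur_bound`). -/

/-! ### Bounded reachability through a set of removed vertices -/

section Reach

open Finset

variable {V : Type} [Fintype V]

open Classical in
/-- The union of the sets `X w` over the neighbours `w` of `v`. -/
noncomputable def nbUnion {α : Type} (G : SimpleGraph V) (X : V → Finset α) (v : V) : Finset α :=
  (univ.filter (G.Adj v)).biUnion X

theorem mem_nbUnion {α : Type} {G : SimpleGraph V} {X : V → Finset α} {v : V} {a : α} :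
    a ∈ nbUnion G X v ↔ ∃ w, G.Adj v w ∧ a ∈ X w := by
  simp [nbUnion]

open Classical in
/-- The vertices of `R` that can be reached from `v` by a walk of length at most `j` all of whose
vertices but the last one avoid `R`. -/
noncomputable def reach (G : SimpleGraph V) (R : Finset V) : ℕ → V → Finset V
  | 0, v => if v ∈ R then {v} else ∅
  | j + 1, v => if v ∈ R then {v} else nbUnion G (reach G R j) v

/-- Walks are functions on `ℕ`, constrained only up to index `l`; truncating, shifting and reversing
them is then index arithmetic. -/
theorem mem_reach_iff {G : SimpleGraph V} {R : Finset V} {j : ℕ} {u v : V} :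
    u ∈ reach G R j v ↔ u ∈ R ∧ ∃ l ≤ j, ∃ p : ℕ → V, p 0 = v ∧ p l = u ∧
      ∀ i < l, p i ∉ R ∧ G.Adj (p i) (p (i + 1)) := by
  induction j generalizing v with
  | zero =>
    constructor
    · intro h
      by_cases hv : v ∈ R
      · simp only [reach, hv, if_true, mem_singleton] at h
        subst h
        exact ⟨hv, 0, le_rfl, fun _ => u, rfl, rfl, by simp⟩
      · simp [reach, hv] at h
    · rintro ⟨hu, l, hl, p, h0, hlu, -⟩
      obtain rfl : l = 0 := by omega
      obtain rfl : u = v := by rw [← h0, hlu]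
      simp [reach, hu]
  | succ j ih =>
    by_cases hv : v ∈ R
    · simp only [reach, hv, if_true, mem_singleton]
      constructor
      · rintro rfl
        exact ⟨hv, 0, by omega, fun _ => u, rfl, rfl, by simp⟩
      · rintro ⟨hu, l, hl, p, h0, hlu, hp⟩
        rcases Nat.eq_zero_or_pos l with rfl | hl0
        · rw [← hlu, h0]
        · exact absurd (h0 ▸ hv) (hp 0 hl0).1
    · simp only [reach, hv, if_false, mem_nbUnion, ih]
      constructor
      · rintro ⟨w, hw, hu, l, hl, p, h0, hlu, hp⟩
        refine ⟨hu, l + 1, by omega, fun i => if i = 0 then v else p (i - 1), by simp,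
          by simpa using hlu, ?_⟩
        intro i hi
        rcases Nat.eq_zero_or_pos i with rfl | hi0
        · simpa [h0] using ⟨hv, hw⟩
        · obtain ⟨a, rfl⟩ : ∃ a, i = a + 1 := ⟨i - 1, by omega⟩
          simpa using hp a (by omega)
      · rintro ⟨hu, l, hl, p, h0, hlu, hp⟩
        rcases Nat.eq_zero_or_pos l with rfl | hl0
        · exact absurd (by rw [← h0, hlu]; exact hu) hv
        · exact ⟨p 1, h0 ▸ (hp 0 hl0).2, hu, l - 1, by omega, fun i => p (i + 1), rfl,
            by simpa [Nat.sub_add_cancel hl0] using hlu, fun i hi => hp (i + 1) (by omega)⟩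

theorem reach_mono {G : SimpleGraph V} {R : Finset V} {i j : ℕ} (h : i ≤ j) (v : V) :
    reach G R i v ⊆ reach G R j v := by
  intro u hu
  obtain ⟨hu, l, hl, hp⟩ := mem_reach_iff.1 hu
  exact mem_reach_iff.2 ⟨hu, l, hl.trans h, hp⟩

theorem reach_of_mem {G : SimpleGraph V} {R : Finset V} {j : ℕ} {v : V} (hv : v ∈ R) :
    reach G R j v = {v} := by
  cases j <;> simp [reach, hv]

/-- If a walk returns to `R`, then the first vertex of `R` on it after its start is reached. -/
theorem exists_first_reach {G : SimpleGraph V} {R : Finset V} {l : ℕ} (hl : 0 < l) {p : ℕ → V}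
    (hp : ∀ i < l, G.Adj (p i) (p (i + 1))) (hR : p l ∈ R) :
    ∃ i, 0 < i ∧ i ≤ l ∧ p i ∈ nbUnion G (reach G R (l - 1)) (p 0) := by
  classical
  have hex : ∃ i, 0 < i ∧ p i ∈ R := ⟨l, hl, hR⟩
  obtain ⟨h0, h1⟩ := Nat.find_spec hex
  have hle : Nat.find hex ≤ l := Nat.find_min' hex ⟨hl, hR⟩
  refine ⟨Nat.find hex, h0, hle, mem_nbUnion.2 ⟨p 1, hp 0 hl, mem_reach_iff.2 ⟨h1,
    Nat.find hex - 1, by omega, fun i => p (i + 1), rfl, by simp [Nat.sub_add_cancel h0], ?_⟩⟩⟩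
  intro i hi
  exact ⟨fun h => Nat.find_min hex (m := i + 1) (by omega) ⟨by omega, h⟩, hp _ (by omega)⟩

/-- A walk between two vertices of `R` with interior outside `R`. -/
theorem exists_walk_of_mem_nbUnion_reach {G : SimpleGraph V} {R : Finset V} {j : ℕ} {u v : V}
    (hu : u ∈ R) (hv : v ∈ nbUnion G (reach G R j) u) :
    ∃ (l : ℕ) (p : ℕ → V), 0 < l ∧ l ≤ j + 1 ∧ p 0 = u ∧ p l = v ∧
      (∀ i < l, G.Adj (p i) (p (i + 1))) ∧
      (∀ i, 0 < i → i < l → p i ∉ R ∧ u ∈ reach G R j (p i) ∧ v ∈ reach G R j (p i)) := by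
  obtain ⟨w, hw, hvw⟩ := mem_nbUnion.1 hv
  obtain ⟨hvR, l, hl, q, h0, hlv, hq⟩ := mem_reach_iff.1 hvw
  obtain ⟨p, hp0, hps⟩ : ∃ p : ℕ → V, p 0 = u ∧ ∀ i, p (i + 1) = q i :=
    ⟨fun i => if i = 0 then u else q (i - 1), by simp, by simp⟩
  have hadj : ∀ i < l + 1, G.Adj (p i) (p (i + 1)) := by
    rintro (_ | i) hi
    · rw [hp0, hps, h0]; exact hw
    · rw [hps, hps]; exact (hq i (by omega)).2
  have hnot : ∀ i, 0 < i → i < l + 1 → p i ∉ R := by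
    rintro (_ | i) hi hi'
    · omega
    · rw [hps]; exact (hq i (by omega)).1
  -- An interior vertex splits a walk of length at most `j + 1` into two nonempty pieces, each of
  -- length at most `j`: the reversed first piece reaches `u`, the second reaches `v`.
  refine ⟨l + 1, p, by omega, by omega, hp0, by rw [hps, hlv], hadj, fun i hi hi' => ⟨hnot i hi hi',
    mem_reach_iff.2 ⟨hu, i, by omega, fun a => p (i - a), by simp, by simp [hp0], ?_⟩,
    mem_reach_iff.2 ⟨hvR, l + 1 - i, by omega, fun a => p (i + a), by simp, ?_, ?_⟩⟩⟩
  · intro a ha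
    refine ⟨hnot _ (by omega) (by omega), ?_⟩
    have := hadj (i - (a + 1)) (by omega)
    rw [show i - (a + 1) + 1 = i - a by omega] at this
    exact this.symm
  · show p (i + (l + 1 - i)) = v
    rw [show i + (l + 1 - i) = l + 1 by omega, hps, hlv]
  · intro a ha
    exact ⟨hnot _ (by omega) (by omega), hadj _ (by omega)⟩

end Reach

/-! ### Density of short connections -/

section Density

open Finset

variable {V : Type} [Fintype V]

/-- Short paths with pairwise disjoint interiors between the vertices of `R` form a shallow
minor, so there are few of them. -/
theorem card_le_of_disjoint_walks {G : SimpleGraph V} {R : Finset V} {k d : ℕ}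
    (hG : ∀ (W : Type) [Finite W] (H : SimpleGraph W), IsShallowMinor k H G → averageDegree H ≤ d)
    (F : Finset (V × V)) (hF : ∀ e ∈ F, e.1 ∈ R ∧ e.2 ∈ R ∧ e.1 ≠ e.2)
    (l : V × V → ℕ) (p : V × V → ℕ → V)
    (hl : ∀ e ∈ F, 0 < l e ∧ l e ≤ k) (h0 : ∀ e ∈ F, p e 0 = e.1) (h1 : ∀ e ∈ F, p e (l e) = e.2)
    (hadj : ∀ e ∈ F, ∀ i < l e, G.Adj (p e i) (p e (i + 1)))
    (hnot : ∀ e ∈ F, ∀ i, 0 < i → i < l e → p e i ∉ R)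
    (hdisj : ∀ e ∈ F, ∀ e' ∈ F, ∀ i i', 0 < i → i < l e → 0 < i' → i' < l e' →
      p e i = p e' i' → e = e') :
    F.card ≤ d * R.card := by
  classical
  let H : SimpleGraph {x // x ∈ R} := SimpleGraph.fromRel fun u v => (u.1, v.1) ∈ F
  -- Each walk is given, without its last vertex, to the branch set of its first endpoint; its last
  -- edge then joins the two branch sets.
  let S : {x // x ∈ R} → Set V := fun u => {x | x = u.1 ∨ ∃ e ∈ F, e.1 = u.1 ∧
    ∃ i, 0 < i ∧ i < l e ∧ p e i = x}
  have hpS : ∀ (u : {x // x ∈ R}) (e), e ∈ F → e.1 = u.1 → ∀ i < l e, p e i ∈ S u := by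
    intro u e he heu i hi
    rcases Nat.eq_zero_or_pos i with rfl | hi0
    · exact Or.inl (by rw [h0 e he, heu])
    · exact Or.inr ⟨e, he, heu, i, hi0, hi, rfl⟩
  have hminor : IsShallowMinor k H G := by
    refine ⟨fun u => (⊤ : G.Subgraph).induce (S u), ?_, ?_, ?_⟩
    · intro u
      let M := (⊤ : G.Subgraph).induce (S u)
      have hu : u.1 ∈ M.verts := Or.inl rfl
      have hdist : ∀ x : M.verts, M.coe.edist ⟨u.1, hu⟩ x ≤ (k : ℕ∞) := by
        rintro ⟨x, hx⟩
        rcases hx with rfl | ⟨e, he, heu, i, hi0, hi, rfl⟩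
        · simp
        · have key : ∀ a (ha : a < l e),
              M.coe.edist ⟨u.1, hu⟩ ⟨p e a, hpS u e he heu a ha⟩ ≤ (a : ℕ∞) := by
            intro a
            induction a with
            | zero =>
              intro ha
              have : (⟨u.1, hu⟩ : M.verts) = ⟨p e 0, hpS u e he heu 0 ha⟩ :=
                Subtype.ext ((h0 e he).trans heu).symm
              rw [this]; simp
            | succ a ih =>
              intro ha
              refine (SimpleGraph.edist_triangle (v := ⟨p e a, hpS u e he heu a (by omega)⟩)).trans ?_
              push_cast
              refine add_le_add (ih (by omega)) (le_of_eq ?_)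
              rw [SimpleGraph.edist_eq_one_iff_adj]
              simp only [M, SimpleGraph.Subgraph.coe_adj, SimpleGraph.Subgraph.induce_adj,
                SimpleGraph.Subgraph.top_adj]
              exact ⟨hpS u e he heu a (by omega), hpS u e he heu (a + 1) ha, hadj e he a (by omega)⟩
          exact (key i hi).trans (by exact_mod_cast hi.le.trans (hl e he).2)
      refine ⟨?_, ?_⟩
      · refine (SimpleGraph.Subgraph.connected_iff' ).2 ?_
        have : Nonempty M.verts := ⟨⟨u.1, hu⟩⟩
        refine (SimpleGraph.connected_iff_exists_forall_reachable _).2 ⟨⟨u.1, hu⟩, fun x => ?_⟩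
        refine SimpleGraph.reachable_of_edist_ne_top (ne_top_of_le_ne_top ?_ (hdist x))
        exact ENat.natCast_ne_top k
      · refine (iInf_le _ (⟨u.1, hu⟩ : M.verts)).trans ?_
        exact iSup_le hdist
    · intro u v huv
      rw [Set.disjoint_left]
      have hne : u.1 ≠ v.1 := fun h => huv (Subtype.ext h)
      rintro x (rfl | ⟨e, he, heu, i, hi0, hi, rfl⟩) (h | ⟨e', he', heu', i', hi0', hi', h⟩)
      · exact hne h
      · exact hnot e' he' i' hi0' hi' (h ▸ u.2)
      · exact hnot e he i hi0 hi (h ▸ v.2)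
      · have := hdisj e he e' he' i i' hi0 hi hi0' hi' h.symm
        exact hne (by rw [← heu, ← heu', this])
    · have key : ∀ u v : {x // x ∈ R}, (u.1, v.1) ∈ F →
          ∃ x ∈ S u, ∃ y ∈ S v, G.Adj x y := by
        intro u v he
        obtain ⟨hl0, -⟩ := hl _ he
        have ha := hadj _ he (l (u.1, v.1) - 1) (by omega)
        rw [Nat.sub_add_cancel hl0, h1 _ he] at ha
        exact ⟨_, hpS u _ he rfl _ (by omega), v.1, Or.inl rfl, ha⟩
      intro u v huv
      rw [SimpleGraph.fromRel_adj] at huv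
      rcases huv.2 with h | h
      · exact key u v h
      · obtain ⟨x, hx, y, hy, hxy⟩ := key v u h
        exact ⟨y, hy, x, hx, hxy.symm⟩
  have havg := hG _ H hminor
  -- Ordered pairs inject into darts, and the average degree counts exactly the darts per vertex, so
  -- no factor is lost.
  have hdart : F.card ≤ Fintype.card H.Dart := by
    have hadjF : ∀ e : {e // e ∈ F}, H.Adj ⟨e.1.1, (hF e.1 e.2).1⟩ ⟨e.1.2, (hF e.1 e.2).2.1⟩ := by
      intro e
      rw [SimpleGraph.fromRel_adj]
      exact ⟨fun h => (hF e.1 e.2).2.2 (congrArg Subtype.val h), Or.inl e.2⟩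
    rw [← Fintype.card_coe]
    refine Fintype.card_le_of_injective (fun e => ⟨(_, _), hadjF e⟩) ?_
    intro e e' h
    have h1 := congrArg (fun a : H.Dart => (a.fst.1, a.snd.1)) h
    exact Subtype.ext h1
  rw [SimpleGraph.dart_card_eq_twice_card_edges] at hdart
  have hE : H.edgeSet.ncard = H.edgeFinset.card := by
    rw [← SimpleGraph.coe_edgeFinset, Set.ncard_coe_finset]
  rcases Nat.eq_zero_or_pos R.card with hR | hR
  · have : F = ∅ := Finset.eq_empty_of_forall_notMem fun e he => by
      have := (hF e he).1
      rw [Finset.card_eq_zero.1 hR] at this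
      simp at this
    simp [this]
  · have hW : Nat.card {x // x ∈ R} = R.card := by simp
    rw [averageDegree, hE, hW, div_le_iff₀ (by exact_mod_cast hR)] at havg
    exact hdart.trans (by exact_mod_cast havg)

-- Choose a maximal family of pairs whose connecting walks have disjoint interiors. It has at most
-- `d * R.card` members and each has at most `j` interior vertices; a pair outside the family has
-- both ends in `reach G R j x` for one of these vertices `x`, which allows `t ^ 2` pairs per `x`.
open Classical in
theorem sum_card_nbUnion_reach_le {G : SimpleGraph V} {R : Finset V} {k d j t : ℕ} (hjk : j < k)
    (hG : ∀ (W : Type) [Finite W] (H : SimpleGraph W), IsShallowMinor k H G → averageDegree H ≤ d)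
    (ht : ∀ x, (reach G R j x).card ≤ t) :
    ∑ u ∈ R, ((nbUnion G (reach G R j) u).erase u).card ≤ (1 + j * t ^ 2) * d * R.card := by
  let E : Finset (V × V) := R.biUnion fun u => ((nbUnion G (reach G R j) u).erase u).image (u, ·)
  have hE : ∀ e, e ∈ E ↔ e.1 ∈ R ∧ e.2 ≠ e.1 ∧ e.2 ∈ nbUnion G (reach G R j) e.1 := by
    rintro ⟨u, v⟩
    simp [E]
  have hEcard : E.card = ∑ u ∈ R, ((nbUnion G (reach G R j) u).erase u).card := by
    rw [card_biUnion]
    · refine sum_congr rfl fun u _ => card_image_of_injective _ fun a b h => ?_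
      simpa using h
    · intro u _ v _ huv
      rw [Function.onFun, Finset.disjoint_left]
      intro e he he'
      simp only [mem_image] at he he'
      obtain ⟨a, -, rfl⟩ := he
      obtain ⟨b, -, hb⟩ := he'
      exact huv (congrArg Prod.fst hb).symm
  have hwalk : ∀ e : V × V, ∃ (l : ℕ) (p : ℕ → V), e ∈ E → 0 < l ∧ l ≤ j + 1 ∧ p 0 = e.1 ∧
      p l = e.2 ∧ (∀ i < l, G.Adj (p i) (p (i + 1))) ∧
      (∀ i, 0 < i → i < l → p i ∉ R ∧ e.1 ∈ reach G R j (p i) ∧ e.2 ∈ reach G R j (p i)) := by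
    intro e
    by_cases he : e ∈ E
    · obtain ⟨l, p, h⟩ := exists_walk_of_mem_nbUnion_reach ((hE e).1 he).1 ((hE e).1 he).2.2
      exact ⟨l, p, fun _ => h⟩
    -- A dummy walk, so that `choose` yields functions on all pairs.
    · exact ⟨0, fun _ => e.1, fun h => absurd h he⟩
  choose l p hlp using hwalk
  let I : V × V → Finset V := fun e => (Ioo 0 (l e)).image (p e)
  have hI : ∀ e x, x ∈ I e ↔ ∃ i, 0 < i ∧ i < l e ∧ p e i = x := by
    intro e x
    simp [I, and_assoc]
  have hIcard : ∀ e ∈ E, (I e).card ≤ j := by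
    intro e he
    refine card_image_le.trans ?_
    have := (hlp e he).2.1
    simp only [Nat.card_Ioo]
    omega
  obtain ⟨F, hF, hmax⟩ := Finset.exists_max_image
    (E.powerset.filter fun F => ∀ e ∈ F, ∀ e' ∈ F, e ≠ e' → Disjoint (I e) (I e')) Finset.card
    ⟨∅, by simp⟩
  simp only [mem_filter, mem_powerset] at hF hmax
  obtain ⟨hFE, hFd⟩ := hF
  have hcover : E ⊆ F ∪ (F.biUnion I).biUnion fun x => reach G R j x ×ˢ reach G R j x := by
    intro e he
    by_contra hcon
    simp only [mem_union, mem_biUnion, mem_product, not_or, not_exists, not_and] at hcon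
    obtain ⟨heF, hcon⟩ := hcon
    have hdis : ∀ f ∈ F, Disjoint (I e) (I f) := by
      intro f hf
      rw [Finset.disjoint_left]
      intro x hx hx'
      obtain ⟨i, hi0, hi, rfl⟩ := (hI _ _).1 hx
      have := (hlp e he).2.2.2.2.2 i hi0 hi
      exact hcon _ ⟨f, hf, hx'⟩ this.2.1 this.2.2
    -- An uncovered pair has a walk disjoint from all those of `F`, and adding it contradicts
    -- maximality.
    have := hmax (insert e F) ⟨insert_subset he hFE, ?_⟩
    · rw [card_insert_of_notMem heF] at this
      omega
    · intro a ha b hb hab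
      rw [mem_insert] at ha hb
      rcases ha with rfl | ha <;> rcases hb with rfl | hb
      · exact absurd rfl hab
      · exact hdis b hb
      · exact (hdis a ha).symm
      · exact hFd a ha b hb hab
  have hFcard : F.card ≤ d * R.card := by
    refine card_le_of_disjoint_walks hG F ?_ l p ?_ ?_ ?_ ?_ ?_ ?_
    · intro e he
      have h := (hE e).1 (hFE he)
      obtain ⟨w, -, hw⟩ := mem_nbUnion.1 h.2.2
      exact ⟨h.1, (mem_reach_iff.1 hw).1, h.2.1.symm⟩
    · intro e he
      have := hlp e (hFE he)
      exact ⟨this.1, by omega⟩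
    · exact fun e he => (hlp e (hFE he)).2.2.1
    · exact fun e he => (hlp e (hFE he)).2.2.2.1
    · exact fun e he => (hlp e (hFE he)).2.2.2.2.1
    · exact fun e he i hi hi' => ((hlp e (hFE he)).2.2.2.2.2 i hi hi').1
    · intro e he e' he' i i' hi0 hi hi0' hi' h
      by_contra hne
      exact Finset.disjoint_left.1 (hFd e he e' he' hne) ((hI _ _).2 ⟨i, hi0, hi, rfl⟩)
        ((hI _ _).2 ⟨i', hi0', hi', h.symm⟩)
  calc _ = E.card := hEcard.symm
    _ ≤ F.card + (F.card * j) * t ^ 2 := by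
      refine (card_le_card hcover).trans ((card_union_le _ _).trans (Nat.add_le_add_left ?_ _))
      refine (card_biUnion_le_card_mul _ _ (t ^ 2) fun x _ => ?_).trans
        (Nat.mul_le_mul_right _ (card_biUnion_le_card_mul _ _ j fun e he => hIcard e (hFE he)))
      rw [card_product, sq]
      exact Nat.mul_le_mul (ht x) (ht x)
    _ = (1 + j * t ^ 2) * F.card := by ring
    _ ≤ (1 + j * t ^ 2) * (d * R.card) := Nat.mul_le_mul_left _ hFcard
    _ = _ := by ring

end Density

/-! ### Peeling off the vertices with few short connections -/

section Peeling

open Finset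

/-- The bound on the number of removed-avoiding connections of length at most `j`. -/
def reachBound (k d : ℕ) : ℕ → ℕ
  | 0 => 1
  | j + 1 => 2 * k * ((1 + j * reachBound k d j ^ 2) * d + 1) * reachBound k d j

/-- The number of connections of length at most `j + 1` up to which a vertex may be removed. -/
def peelBound (k d j : ℕ) : ℕ := 2 * k * ((1 + j * reachBound k d j ^ 2) * d + 1)

/-- The bound on the number of weakly reachable vertices. -/
def weakBound (k d : ℕ) : ℕ → ℕ
  | 0 => 1
  | j + 1 => 1 + peelBound k d j * weakBound k d j

theorem reachBound_pos {k d : ℕ} (hk : 0 < k) (j : ℕ) : 0 < reachBound k d j := by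
  induction j with
  | zero => simp [reachBound]
  | succ j ih => rw [reachBound]; positivity

theorem reachBound_mono {k d : ℕ} (hk : 0 < k) : Monotone (reachBound k d) := by
  refine monotone_nat_of_le_succ fun j => ?_
  rw [reachBound]
  exact Nat.le_mul_of_pos_left _ (by positivity)

theorem weakBound_pos (k d j : ℕ) : 0 < weakBound k d j := by
  cases j <;> simp [weakBound]

variable {V : Type} [Fintype V]

/-- The vertex `v` has few connections of length at most `k` to `R`. -/
def IsPeelable (G : SimpleGraph V) (k d : ℕ) (R : Finset V) (v : V) : Prop :=
  ∀ j < k, (nbUnion G (reach G R j) v).card ≤ peelBound k d j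

open Classical in
/-- The vertices that are left after `p` phases of peeling. -/
noncomputable def remaining (G : SimpleGraph V) (k d : ℕ) : ℕ → Finset V
  | 0 => univ
  | p + 1 => (remaining G k d p).filter fun v => ¬ IsPeelable G k d (remaining G k d p) v

theorem mem_remaining_succ {G : SimpleGraph V} {k d p : ℕ} {v : V} :
    v ∈ remaining G k d (p + 1) ↔
      v ∈ remaining G k d p ∧ ¬ IsPeelable G k d (remaining G k d p) v := by
  simp [remaining]

theorem remaining_antitone (G : SimpleGraph V) (k d : ℕ) : Antitone (remaining G k d) :=
  antitone_nat_of_succ_le fun _ => fun _ hv => (mem_remaining_succ.1 hv).1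

theorem exists_peelable_of_notMem {G : SimpleGraph V} {k d p : ℕ} {v : V}
    (hv : v ∉ remaining G k d p) :
    ∃ q < p, v ∈ remaining G k d q ∧ v ∉ remaining G k d (q + 1) ∧
      IsPeelable G k d (remaining G k d q) v := by
  induction p with
  | zero => simp [remaining] at hv
  | succ p ih =>
    by_cases h : v ∈ remaining G k d p
    · exact ⟨p, by omega, h, hv, by_contra fun h' => hv (mem_remaining_succ.2 ⟨h, h'⟩)⟩
    · obtain ⟨q, hq, h⟩ := ih h
      exact ⟨q, by omega, h⟩

/-- A vertex `w` outside the current set was peeled in an earlier phase `q`. A walk from `w` to the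
current set first returns to the larger set of phase `q` at one of at most `peelBound k d j`
vertices, and at least one step has been used up by then. This gives the recursion of `reachBound`,
whose values do not depend on the number of phases. -/
theorem card_reach_remaining_le {G : SimpleGraph V} {k d : ℕ} (hk : 0 < k) (p : ℕ) {j : ℕ}
    (hj : j ≤ k) (w : V) : (reach G (remaining G k d p) j w).card ≤ reachBound k d j := by
  classical
  induction j generalizing w with
  | zero =>
    simp only [reach, reachBound]
    split_ifs <;> simp
  | succ j ih =>
    by_cases hw : w ∈ remaining G k d p
    · rw [reach_of_mem hw, card_singleton]
      exact reachBound_pos hk _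
    · obtain ⟨q, hq, hwq, -, hpeel⟩ := exists_peelable_of_notMem hw
      have hsub : reach G (remaining G k d p) (j + 1) w ⊆
          (nbUnion G (reach G (remaining G k d q) j) w).biUnion
            (reach G (remaining G k d p) j) := by
        intro u hu
        obtain ⟨huR, l, hl, f, h0, hlu, hf⟩ := mem_reach_iff.1 hu
        have hl0 : 0 < l := Nat.pos_of_ne_zero fun h => hw (by subst h; rw [← h0, hlu]; exact huR)
        obtain ⟨i, hi0, hil, hi⟩ := exists_first_reach (R := remaining G k d q) hl0
          (fun i hi => (hf i hi).2) (by rw [hlu]; exact remaining_antitone G k d hq.le huR)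
        obtain ⟨y, hy, hiy⟩ := mem_nbUnion.1 hi
        refine mem_biUnion.2 ⟨f i, mem_nbUnion.2 ⟨y, h0 ▸ hy, reach_mono (by omega) y hiy⟩,
          mem_reach_iff.2 ⟨huR, l - i, by omega, fun a => f (i + a), rfl, ?_, ?_⟩⟩
        · simpa [Nat.add_sub_cancel' hil] using hlu
        · exact fun a ha => hf (i + a) (by omega)
      refine (card_le_card hsub).trans ((card_biUnion_le_card_mul _ _ _ fun x _ =>
        ih (by omega) x).trans ?_)
      rw [reachBound]
      exact Nat.mul_le_mul_right _ (hpeel j (by omega))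

/-- Markov's inequality for each `j < k`: the factor `2 * k` in `peelBound` leaves at most a
fraction `1 / (2 * k)` of `R` bad for `j`, and a survivor is bad for some `j`. -/
theorem two_mul_card_remaining_succ_le {G : SimpleGraph V} {k d : ℕ} (hk : 0 < k)
    (hG : ∀ (W : Type) [Finite W] (H : SimpleGraph W), IsShallowMinor k H G → averageDegree H ≤ d)
    (p : ℕ) : 2 * (remaining G k d (p + 1)).card ≤ (remaining G k d p).card := by
  classical
  set R := remaining G k d p with hR
  let bad : ℕ → Finset V := fun j =>
    R.filter fun v => peelBound k d j < (nbUnion G (reach G R j) v).card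
  have hbad : ∀ j < k, 2 * k * (bad j).card ≤ R.card := by
    intro j hj
    have h1 := sum_card_nbUnion_reach_le (R := R) hj hG
      (fun x => card_reach_remaining_le hk p hj.le x)
    have h2 : (bad j).card * peelBound k d j ≤
        ∑ u ∈ R, ((nbUnion G (reach G R j) u).erase u).card := by
      rw [← smul_eq_mul]
      refine (card_nsmul_le_sum _ _ _ fun u hu => ?_).trans
        (sum_le_sum_of_subset (filter_subset _ _))
      -- A vertex may be connected to itself by a closed walk; erasing it costs one, which the
      -- strict inequality in `bad` absorbs.
      have := (mem_filter.1 hu).2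
      have h3 := pred_card_le_card_erase (s := nbUnion G (reach G R j) u) (a := u)
      omega
    have h4 := h2.trans h1
    set a := (1 + j * reachBound k d j ^ 2) * d with ha
    have h5 : (a + 1) * (2 * k * (bad j).card) ≤ (a + 1) * R.card :=
      calc _ = (bad j).card * peelBound k d j := by rw [peelBound, ← ha]; ring
        _ ≤ a * R.card := h4
        _ ≤ _ := Nat.mul_le_mul_right _ (by omega)
    -- The summand `+ 1` in `peelBound` makes the cancelled factor positive even when `a = 0`.
    exact Nat.le_of_mul_le_mul_left h5 (by omega)
  have hsub : remaining G k d (p + 1) ⊆ (range k).biUnion bad := by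
    intro v hv
    obtain ⟨h1, h2⟩ := mem_remaining_succ.1 hv
    simp only [IsPeelable, not_forall, not_le] at h2
    obtain ⟨j, hj, h⟩ := h2
    exact mem_biUnion.2 ⟨j, mem_range.2 hj, mem_filter.2 ⟨h1, h⟩⟩
  have h6 : 2 * k * (remaining G k d (p + 1)).card ≤ k * R.card :=
    calc _ ≤ 2 * k * ∑ j ∈ range k, (bad j).card :=
          Nat.mul_le_mul_left _ ((card_le_card hsub).trans card_biUnion_le)
      _ = ∑ j ∈ range k, 2 * k * (bad j).card := mul_sum _ _ _
      _ ≤ ∑ j ∈ range k, R.card := sum_le_sum fun j hj => hbad j (mem_range.1 hj)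
      _ = k * R.card := by simp
  exact (Nat.mul_le_mul_left_iff hk).1 (by linarith)

theorem remaining_eq_empty {G : SimpleGraph V} {k d : ℕ} (hk : 0 < k)
    (hG : ∀ (W : Type) [Finite W] (H : SimpleGraph W), IsShallowMinor k H G → averageDegree H ≤ d)
    {m : ℕ} (hm : Fintype.card V < 2 ^ m) : remaining G k d m = ∅ := by
  have h : ∀ p, 2 ^ p * (remaining G k d p).card ≤ Fintype.card V := by
    intro p
    induction p with
    | zero => simpa using card_le_univ _
    | succ p ih =>
      refine le_trans ?_ ih
      rw [pow_succ, mul_assoc]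
      exact Nat.mul_le_mul_left _ (two_mul_card_remaining_succ_le hk hG p)
  by_contra hne
  have h1 := card_pos.2 (nonempty_iff_ne_empty.2 hne)
  have h2 := h m
  have : 2 ^ m * 1 ≤ 2 ^ m * (remaining G k d m).card := Nat.mul_le_mul_left _ h1
  omega

open Classical in
/-- The number of the first `m` phases that `v` survives. -/
noncomputable def layer (G : SimpleGraph V) (k d m : ℕ) (v : V) : ℕ :=
  ((range m).filter fun p => v ∈ remaining G k d (p + 1)).card

open Classical in
theorem layer_le (G : SimpleGraph V) (k d m : ℕ) (v : V) : layer G k d m v ≤ m :=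
  (card_filter_le _ _).trans (by simp)

open Classical in
theorem layer_succ (G : SimpleGraph V) (k d m : ℕ) (v : V) :
    layer G k d (m + 1) v =
      if v ∈ remaining G k d (m + 1) then layer G k d m v + 1 else layer G k d m v := by
  rw [layer, range_add_one, filter_insert]
  split_ifs with h
  · rw [card_insert_of_notMem (by simp)]; rfl
  · rfl

/-- The remaining sets are nested, so a counter that a vertex can keep locally determines its
membership in all of them up to phase `m`. -/
theorem mem_remaining_iff {G : SimpleGraph V} {k d m p : ℕ} (hp : p ≤ m) {v : V} :
    v ∈ remaining G k d p ↔ p ≤ layer G k d m v := by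
  classical
  constructor
  · intro hv
    calc p = (range p).card := (card_range p).symm
      _ ≤ _ := card_le_card fun i hi => by
        rw [mem_range] at hi
        exact mem_filter.2 ⟨mem_range.2 (by omega),
          remaining_antitone G k d (show i + 1 ≤ p by omega) hv⟩
  · intro h
    by_contra hv
    have hsub : ((range m).filter fun i => v ∈ remaining G k d (i + 1)) ⊆ range (p - 1) := by
      intro i hi
      obtain ⟨-, hi⟩ := mem_filter.1 hi
      rw [mem_range]
      by_contra hcon
      exact hv (remaining_antitone G k d (show p ≤ i + 1 by omega) hi)
    have h1 := card_le_card hsub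
    rw [card_range] at h1
    have hp0 : p ≠ 0 := by rintro rfl; exact hv (by simp [remaining])
    change layer G k d m v ≤ p - 1 at h1
    omega

open Classical in
/-- The vertices `u` that can be reached from `v` by a walk of length at most `j` on which `u`
has the largest layer. -/
noncomputable def weakReach (G : SimpleGraph V) (lay : V → ℕ) (j : ℕ) (v : V) : Finset V :=
  univ.filter fun u => ∃ l ≤ j, ∃ p : ℕ → V, p 0 = v ∧ p l = u ∧
    (∀ i < l, G.Adj (p i) (p (i + 1))) ∧ ∀ i ≤ l, lay (p i) ≤ lay u

theorem mem_weakReach {G : SimpleGraph V} {lay : V → ℕ} {j : ℕ} {u v : V} :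
    u ∈ weakReach G lay j v ↔ ∃ l ≤ j, ∃ p : ℕ → V, p 0 = v ∧ p l = u ∧
      (∀ i < l, G.Adj (p i) (p (i + 1))) ∧ ∀ i ≤ l, lay (p i) ≤ lay u := by
  simp [weakReach]

/-- If `v` is peeled in phase `q`, a target of layer at least that of `v` still lies in the set of
phase `q`. The walk to it first returns to this set at one of boundedly many vertices, and the rest
of the walk is shorter with the same maximal target. -/
theorem card_weakReach_le {G : SimpleGraph V} {k d m : ℕ} (hm : remaining G k d m = ∅) {j : ℕ}
    (hj : j ≤ k) (v : V) : (weakReach G (layer G k d m) j v).card ≤ weakBound k d j := by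
  classical
  induction j generalizing v with
  | zero =>
    refine card_le_one.2 fun a ha b hb => ?_
    obtain ⟨l, hl, p, h0, hla, -⟩ := mem_weakReach.1 ha
    obtain ⟨l', hl', p', h0', hla', -⟩ := mem_weakReach.1 hb
    obtain rfl : l = 0 := by omega
    obtain rfl : l' = 0 := by omega
    rw [← hla, ← hla', h0, h0']
  | succ j ih =>
    obtain ⟨q, hq, hvq, hvq', hpeel⟩ :=
      exists_peelable_of_notMem (show v ∉ remaining G k d m by simp [hm])
    have hv : layer G k d m v = q := by
      have h1 := (mem_remaining_iff hq.le).1 hvq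
      have h2 := mt (mem_remaining_iff hq).2 hvq'
      omega
    have hsub : weakReach G (layer G k d m) (j + 1) v ⊆
        {v} ∪ (nbUnion G (reach G (remaining G k d q) j) v).biUnion
          (weakReach G (layer G k d m) j) := by
      intro u hu
      obtain ⟨l, hl, f, h0, hlu, hf, hlay⟩ := mem_weakReach.1 hu
      rcases Nat.eq_zero_or_pos l with rfl | hl0
      · rw [← hlu, h0]; simp
      · have huq : u ∈ remaining G k d q := by
          rw [mem_remaining_iff hq.le, ← hv, ← h0]
          exact hlay 0 (by omega)
        obtain ⟨i, hi0, hil, hi⟩ := exists_first_reach (R := remaining G k d q) hl0 hf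
          (by rw [hlu]; exact huq)
        obtain ⟨y, hy, hiy⟩ := mem_nbUnion.1 hi
        refine mem_union_right _ (mem_biUnion.2 ⟨f i, mem_nbUnion.2 ⟨y, h0 ▸ hy,
          reach_mono (by omega) y hiy⟩, mem_weakReach.2 ⟨l - i, by omega, fun a => f (i + a), rfl,
          ?_, fun a ha => hf (i + a) (by omega), fun a ha => hlay (i + a) (by omega)⟩⟩)
        simpa [Nat.add_sub_cancel' hil] using hlu
    refine (card_le_card hsub).trans ((card_union_le _ _).trans ?_)
    rw [weakBound, card_singleton]
    refine Nat.add_le_add_left ((card_biUnion_le_card_mul _ _ _ fun x _ =>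
      ih (by omega) x).trans (Nat.mul_le_mul_right _ (hpeel j (by omega)))) _

end Peeling

/-! ### Domination by the vertices of largest key -/

section Domination

open Finset

variable {V : Type}

theorem edist_le_iff_exists_walk {G : SimpleGraph V} {u v : V} {i : ℕ} :
    G.edist v u ≤ (i : ℕ∞) ↔ ∃ l ≤ i, ∃ p : ℕ → V, p 0 = v ∧ p l = u ∧
      ∀ a < l, G.Adj (p a) (p (a + 1)) := by
  constructor
  · intro h
    obtain ⟨w, hw⟩ := SimpleGraph.exists_walk_of_edist_ne_top
      (ne_top_of_le_ne_top (ENat.natCast_ne_top i) h)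
    refine ⟨w.length, ?_, w.getVert, w.getVert_zero, w.getVert_length,
      fun a ha => w.adj_getVert_succ ha⟩
    rw [← hw] at h
    exact_mod_cast h
  · rintro ⟨l, hl, p, rfl, rfl, hp⟩
    have key : ∀ a ≤ l, G.edist (p 0) (p a) ≤ (a : ℕ∞) := by
      intro a
      induction a with
      | zero => simp
      | succ a ih =>
        intro ha
        refine (SimpleGraph.edist_triangle (v := p a)).trans ?_
        push_cast
        exact add_le_add (ih (by omega))
          (SimpleGraph.edist_eq_one_iff_adj.2 (hp a (by omega))).le
    exact (key l le_rfl).trans (by exact_mod_cast hl)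

theorem edist_le_succ_iff {G : SimpleGraph V} {u v : V} {i : ℕ} :
    G.edist v u ≤ ((i + 1 : ℕ) : ℕ∞) ↔
      G.edist v u ≤ (i : ℕ∞) ∨ ∃ w, G.Adj v w ∧ G.edist w u ≤ (i : ℕ∞) := by
  constructor
  · intro h
    obtain ⟨l, hl, p, h0, hlu, hp⟩ := edist_le_iff_exists_walk.1 h
    rcases Nat.eq_zero_or_pos l with rfl | hl0
    · left
      rw [← h0, ← hlu]; simp
    · right
      exact ⟨p 1, h0 ▸ hp 0 hl0, edist_le_iff_exists_walk.2 ⟨l - 1, by omega, fun a => p (a + 1),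
        rfl, by simpa [Nat.sub_add_cancel hl0] using hlu, fun a ha => hp (a + 1) (by omega)⟩⟩
  · rintro (h | ⟨w, hw, h⟩)
    · exact h.trans (by exact_mod_cast Nat.le_succ i)
    · refine (SimpleGraph.edist_triangle (v := w)).trans ?_
      rw [SimpleGraph.edist_eq_one_iff_adj.2 hw, add_comm]
      push_cast
      exact add_le_add_left h 1

variable [Fintype V]

/-- The largest key within distance `i`, computed by flooding. -/
noncomputable def maxKey (G : SimpleGraph V) (key : V → ℕ) : ℕ → V → ℕ
  | 0, v => key v
  | i + 1, v => ({maxKey G key i v} ∪ nbUnion G (fun w => {maxKey G key i w}) v : Finset ℕ).sup id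

/-- The union of the sets `X w` over the vertices `w` within distance `i`, computed by flooding. -/
noncomputable def spread (G : SimpleGraph V) (X : V → Finset ℕ) : ℕ → V → Finset ℕ
  | 0, v => X v
  | i + 1, v => spread G X i v ∪ nbUnion G (spread G X i) v

theorem key_le_maxKey {G : SimpleGraph V} {key : V → ℕ} {i : ℕ} {u v : V}
    (h : G.edist v u ≤ (i : ℕ∞)) : key u ≤ maxKey G key i v := by
  induction i generalizing v with
  | zero =>
    have : v = u := by simpa using h
    rw [this, maxKey]
  | succ i ih =>
    rw [maxKey]
    rcases edist_le_succ_iff.1 h with h | ⟨w, hw, h⟩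
    · exact (ih h).trans (Finset.le_sup (f := id) (mem_union_left _ (mem_singleton_self _)))
    · exact (ih h).trans (Finset.le_sup (f := id)
        (mem_union_right _ (mem_nbUnion.2 ⟨w, hw, mem_singleton_self _⟩)))

theorem exists_key_eq_maxKey (G : SimpleGraph V) (key : V → ℕ) (i : ℕ) (v : V) :
    ∃ u, G.edist v u ≤ (i : ℕ∞) ∧ key u = maxKey G key i v := by
  induction i generalizing v with
  | zero => exact ⟨v, by simp, rfl⟩
  | succ i ih =>
    obtain ⟨a, ha, hmax⟩ := Finset.exists_mem_eq_sup
      ({maxKey G key i v} ∪ nbUnion G (fun w => {maxKey G key i w}) v : Finset ℕ)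
      ⟨_, mem_union_left _ (mem_singleton_self _)⟩ id
    rw [maxKey, hmax]
    rcases mem_union.1 ha with ha | ha
    · obtain ⟨u, hu, hk⟩ := ih v
      exact ⟨u, edist_le_succ_iff.2 (Or.inl hu), by rw [hk, id, mem_singleton.1 ha]⟩
    · obtain ⟨w, hw, ha⟩ := mem_nbUnion.1 ha
      obtain ⟨u, hu, hk⟩ := ih w
      exact ⟨u, edist_le_succ_iff.2 (Or.inr ⟨w, hw, hu⟩), by rw [hk, id, mem_singleton.1 ha]⟩

theorem mem_spread {G : SimpleGraph V} {X : V → Finset ℕ} {i a : ℕ} {v : V} :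
    a ∈ spread G X i v ↔ ∃ w, G.edist v w ≤ (i : ℕ∞) ∧ a ∈ X w := by
  induction i generalizing v with
  | zero => simp [spread]
  | succ i ih =>
    simp only [spread, mem_union, mem_nbUnion, ih]
    constructor
    · rintro (⟨w, hw, ha⟩ | ⟨y, hy, w, hw, ha⟩)
      · exact ⟨w, edist_le_succ_iff.2 (Or.inl hw), ha⟩
      · exact ⟨w, edist_le_succ_iff.2 (Or.inr ⟨y, hy, hw⟩), ha⟩
    · rintro ⟨w, hw, ha⟩
      rcases edist_le_succ_iff.1 hw with h | ⟨y, hy, h⟩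
      · exact Or.inl ⟨w, h, ha⟩
      · exact Or.inr ⟨y, hy, w, h, ha⟩

-- The walk from `v` to the electing vertex `w` and on to the elected vertex stays within distance
-- `r` of `w`, where the elected key is maximal. Besides the approximation ratio, this bounds the
-- sets flooded in the last `r` rounds.
open Classical in
theorem spread_maxKey_subset {G : SimpleGraph V} {key lay : V → ℕ}
    (hkey : ∀ u v, key u ≤ key v → lay u ≤ lay v) {i r : ℕ} (hi : i ≤ r) (v : V) :
    spread G (fun w => {maxKey G key r w}) i v ⊆ (weakReach G lay (2 * r) v).image key := by
  intro a ha
  obtain ⟨w, hw, ha⟩ := mem_spread.1 ha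
  rw [mem_singleton] at ha
  obtain ⟨u, hu, hk⟩ := exists_key_eq_maxKey G key r w
  have hball : ∀ x, G.edist w x ≤ (r : ℕ∞) → lay x ≤ lay u :=
    fun x hx => hkey _ _ (hk ▸ key_le_maxKey hx)
  refine mem_image.2 ⟨u, mem_weakReach.2 ?_, by rw [hk, ha]⟩
  obtain ⟨l, hl, p, h0, hlw, hp⟩ := edist_le_iff_exists_walk.1 hw
  obtain ⟨l', hl', q, hq0, hqu, hq⟩ := edist_le_iff_exists_walk.1 hu
  refine ⟨l + l', by omega, fun a => if a < l then p a else q (a - l), ?_, by simp [hqu], ?_, ?_⟩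
  · rcases Nat.eq_zero_or_pos l with rfl | hl0
    · simp [hq0, ← hlw, h0]
    · simp [hl0, h0]
  · intro a ha
    rcases lt_trichotomy (a + 1) l with h | h | h
    · simpa [h, show a < l by omega] using hp a (by omega)
    · have := hp a (by omega)
      rw [h, hlw, ← hq0] at this
      simpa [h, show a < l by omega] using this
    · have := hq (a - l) (by omega)
      rw [show a - l + 1 = a + 1 - l by omega] at this
      simpa [show ¬ a + 1 < l by omega, show ¬ a < l by omega] using this
  · intro a ha
    apply hball
    by_cases h : a < l
    · simp only [h, if_true]
      rw [SimpleGraph.edist_comm]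
      exact edist_le_iff_exists_walk.2 ⟨l - a, by omega, fun b => p (a + b), rfl,
        by simpa [Nat.add_sub_cancel' h.le] using hlw, fun b hb => hp (a + b) (by omega)⟩
    · simp only [h, if_false]
      exact edist_le_iff_exists_walk.2 ⟨a - l, by omega, q, hq0, rfl,
        fun b hb => hq b (by omega)⟩

open Classical in
/-- Electing the vertices that have the largest key in some ball of radius `r` approximates a
minimum distance-`r` dominating set, if few vertices are weakly reachable from each vertex. -/
theorem isApprox_filter_mem_spread {G : SimpleGraph V} {key lay : V → ℕ} {r c : ℕ}
    (hinj : Function.Injective key) (hkey : ∀ u v, key u ≤ key v → lay u ≤ lay v)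
    (hc : ∀ v, (weakReach G lay (2 * r) v).card ≤ c) :
    IsApproxMinDistDominating G r c
      (univ.filter fun v => key v ∈ spread G (fun w => {maxKey G key r w}) r v) := by
  constructor
  · intro w
    obtain ⟨u, hu, hk⟩ := exists_key_eq_maxKey G key r w
    rw [SimpleGraph.edist_comm] at hu
    exact ⟨u, mem_filter.2 ⟨mem_univ _, mem_spread.2 ⟨w, hu, by simp [hk]⟩⟩, hu⟩
  · intro D' hD'
    have hsub : (univ.filter fun v => key v ∈ spread G (fun w => {maxKey G key r w}) r v) ⊆
        D'.biUnion (weakReach G lay (2 * r)) := by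
      intro v hv
      obtain ⟨w, -, hw⟩ := mem_spread.1 (mem_filter.1 hv).2
      obtain ⟨d, hd, hdw⟩ := hD' w
      obtain ⟨u, hu, huv⟩ := mem_image.1
        (spread_maxKey_subset hkey le_rfl d (mem_spread.2 ⟨w, hdw, hw⟩))
      exact mem_biUnion.2 ⟨d, hd, hinj huv ▸ hu⟩
    rw [mul_comm]
    exact (card_le_card hsub).trans (card_biUnion_le_card_mul _ _ _ fun d _ => hc d)

end Domination

/-! ### Encoding small sets of numbers as messages -/

section Encoding

open Finset

theorem card_filter_card_le {N : ℕ} (hN : 2 ≤ N) (M : ℕ) :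
    ((range N).powerset.filter fun s => s.card ≤ M).card ≤ N ^ (2 * M) := by
  have hsub : ((range N).powerset.filter fun s => s.card ≤ M) ⊆
      (range (M + 1)).biUnion fun i => (range N).powersetCard i := by
    intro s hs
    obtain ⟨h1, h2⟩ := mem_filter.1 hs
    exact mem_biUnion.2 ⟨s.card, mem_range.2 (by omega),
      mem_powersetCard.2 ⟨mem_powerset.1 h1, rfl⟩⟩
  refine (card_le_card hsub).trans ((card_biUnion_le_card_mul _ _ (N ^ M) fun i hi => ?_).trans ?_)
  · rw [card_powersetCard, card_range]
    exact (Nat.choose_le_pow N i).trans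
      (Nat.pow_le_pow_right (by omega) (by have := mem_range.1 hi; omega))
  · rw [card_range, two_mul, pow_add]
    exact Nat.mul_le_mul_right _ (Nat.lt_two_pow_self.trans_le (Nat.pow_le_pow_left hN M))

/-- There are at most `2 ^ (6 * M * L)` sets of at most `M` numbers of `3 * L` bits, so they embed
into the bit strings of that length. Other sets get the empty string, and nothing is promised about
decoding them. -/
theorem exists_encoding (M L : ℕ) : ∃ (enc : Finset ℕ → List Bool) (dec : List Bool → Finset ℕ),
    (∀ s, (enc s).length ≤ 6 * M * L) ∧
      (0 < L → ∀ s : Finset ℕ, (∀ x ∈ s, x < 2 ^ (3 * L)) → s.card ≤ M → dec (enc s) = s) := by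
  classical
  rcases Nat.eq_zero_or_pos L with rfl | hL
  · exact ⟨fun _ => [], fun _ => ∅, by simp, by simp⟩
  let Q := (range (2 ^ (3 * L))).powerset.filter fun s => s.card ≤ M
  have hcard : Fintype.card {s // s ∈ Q} ≤ Fintype.card (Fin (6 * M * L) → Bool) := by
    rw [Fintype.card_coe, Fintype.card_fun, Fintype.card_bool, Fintype.card_fin]
    refine (card_filter_card_le ?_ M).trans ?_
    · calc 2 = 2 ^ 1 := rfl
        _ ≤ _ := Nat.pow_le_pow_right (by norm_num) (by omega)
    · rw [← pow_mul]
      exact Nat.pow_le_pow_right (by norm_num) (le_of_eq (by ring))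
  obtain ⟨f⟩ := Function.Embedding.nonempty_of_card_le hcard
  let enc : Finset ℕ → List Bool := fun s => if h : s ∈ Q then List.ofFn (f ⟨s, h⟩) else []
  have hinj : Set.InjOn enc (Q : Set (Finset ℕ)) := by
    intro s hs s' hs' h
    have hs : s ∈ Q := hs
    have hs' : s' ∈ Q := hs'
    simp only [enc, hs, hs', dif_pos] at h
    simpa using f.injective (List.ofFn_injective h)
  refine ⟨enc, Function.invFunOn enc (Q : Set (Finset ℕ)), fun s => ?_, fun _ s hs hsM => ?_⟩
  · simp only [enc]
    split_ifs <;> simp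
  · exact hinj.leftInvOn_invFunOn
      (mem_filter.2 ⟨mem_powerset.2 fun x hx => mem_range.2 (hs x hx), hsM⟩)

end Encoding

/-! ### Algorithms that broadcast small sets of numbers -/

section Simulation

open Finset

/-- The run of an algorithm whose messages are sets of numbers and whose vertices process only the
union of the received messages. -/
noncomputable def setRun {V S : Type} [Fintype V] (G : SimpleGraph V) (init : V → S)
    (msg : S → Finset ℕ) (step : S → Finset ℕ → S) : ℕ → V → S
  | 0, v => init v
  | t + 1, v => step (setRun G init msg step t v)
      (nbUnion G (fun w => msg (setRun G init msg step t w)) v)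

/-- The broadcast algorithm that sends encodings of sets of numbers. -/
def setAlgorithm {S : Type} {B : ℕ} (init : ℕ → ℕ → S) (msg : S → Finset ℕ)
    (step : ℕ → S → Finset ℕ → S) (rounds : ℕ → ℕ) (output : ℕ → S → Bool)
    (enc : ℕ → Finset ℕ → List Bool) (dec : ℕ → List Bool → Finset ℕ)
    (henc : ∀ n s, (enc n s).length ≤ B * Nat.clog 2 n) : CongestBCAlgorithm B where
  State := S
  init n i _ := init n i
  send n x := enc n (msg x)
  receive n x X := step n x (X.biUnion fun a => dec n a.2)
  rounds := rounds
  output := output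
  length_send_le n _ := henc n _

/-- Decoding has to be correct only for messages of the ideal run `setRun`; by induction these are
the messages actually sent. -/
theorem stateAfter_setAlgorithm {S : Type} {B : ℕ} {init : ℕ → ℕ → S} {msg : S → Finset ℕ}
    {step : ℕ → S → Finset ℕ → S} {rounds : ℕ → ℕ} {output : ℕ → S → Bool}
    {enc : ℕ → Finset ℕ → List Bool} {dec : ℕ → List Bool → Finset ℕ}
    {henc : ∀ n s, (enc n s).length ≤ B * Nat.clog 2 n} {V : Type} [Fintype V] {G : SimpleGraph V}
    {ident : V → ℕ} {T : ℕ}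
    (h : ∀ t < T, ∀ v, dec (Fintype.card V) (enc (Fintype.card V)
      (msg (setRun G (fun v => init (Fintype.card V) (ident v)) msg (step (Fintype.card V)) t v))) =
      msg (setRun G (fun v => init (Fintype.card V) (ident v)) msg (step (Fintype.card V)) t v)) :
    ∀ t ≤ T, ∀ v,
      (setAlgorithm init msg step rounds output enc dec henc).stateAfter G ident t v =
        setRun G (fun v => init (Fintype.card V) (ident v)) msg (step (Fintype.card V)) t v := by
  classical
  intro t
  induction t with
  | zero => exact fun _ _ => rfl
  | succ t ih =>
    intro ht v
    rw [CongestBCAlgorithm.stateAfter, setRun, ih (by omega) v]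
    change step _ _ _ = step _ _ _
    congr 1
    ext a
    simp only [mem_biUnion, mem_image, mem_filter, mem_univ, true_and, mem_nbUnion]
    constructor
    · rintro ⟨_, ⟨w, hw, rfl⟩, ha⟩
      refine ⟨w, hw, ?_⟩
      rw [← h t (by omega) w, ← ih (by omega) w]
      exact ha
    · rintro ⟨w, hw, ha⟩
      refine ⟨_, ⟨w, hw, rfl⟩, ?_⟩
      rw [← h t (by omega) w, ← ih (by omega) w] at ha
      exact ha

end Simulation

/-! ### The algorithm -/

section Algorithm

open Finset

/-- The local state of a vertex: its identifier, the number of rounds so far, the number of phases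
it survived, whether it is still present, whether it is still peelable in the current phase, and
the set that it broadcasts next. -/
structure PeelState where
  id : ℕ
  time : ℕ
  lay : ℕ
  active : Bool
  ok : Bool
  cur : Finset ℕ

/-- The key of a vertex, which compares layers first and then identifiers. -/
def vertexKey (L lay i : ℕ) : ℕ := lay * 2 ^ L + i

/-- One round: `m` phases of peeling of `k` rounds each, then `r` rounds that flood the largest key,
then rounds that flood the sets of elected keys. -/
def peelStep (k d r m L : ℕ) (x : PeelState) (U : Finset ℕ) : PeelState :=
  if x.time < k * m then
    let ok := x.ok && decide (U.card ≤ peelBound k d (x.time % k))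
    if x.time % k + 1 < k then
      { x with time := x.time + 1, ok := ok, cur := if x.active then {x.id} else U }
    else
      let active := x.active && !ok
      let lay := if active then x.lay + 1 else x.lay
      { id := x.id
        time := x.time + 1
        lay := lay
        active := active
        ok := true
        cur := if x.time + 1 = k * m then {vertexKey L lay x.id}
          else if active then {x.id} else ∅ }
  else if x.time < k * m + r then
    { x with time := x.time + 1, cur := {(x.cur ∪ U).sup id} }
  else { x with time := x.time + 1, cur := x.cur ∪ U }

/-- The initial state of a vertex. -/
def peelInit (i : ℕ) : PeelState := ⟨i, 0, 0, true, true, {i}⟩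

/-! ### Round-by-round correctness of the peeling and flooding -/

section Run

variable {V : Type} [Fintype V] (G : SimpleGraph V) (ident : V → ℕ) (k d r m L : ℕ)

/-- The run of the algorithm with sets as messages. -/
noncomputable def peelRun : ℕ → V → PeelState :=
  setRun G (fun v => peelInit (ident v)) PeelState.cur (peelStep k d r m L)

theorem peelRun_succ (t : ℕ) (v : V) : peelRun G ident k d r m L (t + 1) v =
    peelStep k d r m L (peelRun G ident k d r m L t v)
      (nbUnion G (fun w => (peelRun G ident k d r m L t w).cur) v) := rfl

open Classical in
/-- The state after `t` rounds of the peeling part. -/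
noncomputable def peelSpec (t : ℕ) (v : V) : PeelState where
  id := ident v
  time := t
  lay := layer G k d (t / k) v
  active := decide (v ∈ remaining G k d (t / k))
  ok := decide (∀ i < t % k,
    (nbUnion G (reach G (remaining G k d (t / k)) i) v).card ≤ peelBound k d i)
  cur := (reach G (remaining G k d (t / k)) (t % k) v).image ident

open Classical in
theorem nbUnion_image {X : V → Finset V} (v : V) :
    nbUnion G (fun w => (X w).image ident) v = (nbUnion G X v).image ident := by
  ext a
  simp only [mem_nbUnion, mem_image]
  constructor
  · rintro ⟨w, hw, u, hu, rfl⟩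
    exact ⟨u, ⟨w, hw, hu⟩, rfl⟩
  · rintro ⟨u, ⟨w, hw, hu⟩, rfl⟩
    exact ⟨w, hw, u, hu, rfl⟩

variable {ident k}

/-- Round `t` is step `t % k` of phase `t / k`. Within a phase, present vertices repeat their
identifier and the others forward the union they received, which is the recursion of `reach`; a new
phase restarts from radius `0`. The very last round is separate because it broadcasts the key
instead. -/
theorem peelStep_peelSpec (hinj : Function.Injective ident) (hk : 0 < k) {t : ℕ} (ht : t < k * m)
    (v : V) :
    let x := peelStep k d r m L (peelSpec G ident k d t v)
      (nbUnion G (fun w => (peelSpec G ident k d t w).cur) v)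
    (t + 1 < k * m → x = peelSpec G ident k d (t + 1) v) ∧
      (t + 1 = k * m → x.id = ident v ∧ x.time = t + 1 ∧ x.lay = layer G k d m v ∧
        x.cur = {vertexKey L (layer G k d m v) (ident v)}) := by
  classical
  intro x
  set R := remaining G k d (t / k) with hR
  set N := nbUnion G (reach G R (t % k)) v with hN
  have hU : nbUnion G (fun w => (peelSpec G ident k d t w).cur) v = N.image ident :=
    nbUnion_image G ident v
  have hUcard : (N.image ident).card = N.card := card_image_of_injective _ hinj
  have hok : (decide (∀ i < t % k, (nbUnion G (reach G R i) v).card ≤ peelBound k d i) &&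
      decide (N.card ≤ peelBound k d (t % k))) =
      decide (∀ i < t % k + 1, (nbUnion G (reach G R i) v).card ≤ peelBound k d i) := by
    rw [← Bool.decide_and, decide_eq_decide]
    constructor
    · rintro ⟨h1, h2⟩ i hi
      rcases Nat.lt_succ_iff_lt_or_eq.1 hi with h | rfl
      · exact h1 i h
      · exact h2
    · exact fun h => ⟨fun i hi => h i (by omega), h _ (by omega)⟩
  have hx : x = peelStep k d r m L (peelSpec G ident k d t v) (N.image ident) := by
    rw [← hU]
  by_cases hj : t % k + 1 < k
  · have hdiv : (t + 1) / k = t / k := by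
      rw [Nat.succ_div, if_neg, add_zero]
      intro h
      have := Nat.add_mod t 1 k
      rw [Nat.mod_eq_zero_of_dvd h, Nat.mod_eq_of_lt (show 1 < k by omega),
        Nat.mod_eq_of_lt hj] at this
      omega
    have hmod : (t + 1) % k = t % k + 1 := by
      rw [Nat.add_mod, Nat.mod_eq_of_lt (show 1 < k by omega), Nat.mod_eq_of_lt hj]
    refine ⟨fun _ => ?_, fun h => ?_⟩
    · rw [hx]
      simp only [peelStep, peelSpec, ht, hj, if_true, hUcard, ← hR, hok, hdiv, hmod]
      congr 1
      by_cases hv : v ∈ R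
      · simp [hv, reach]
      · simp [hv, reach, hN]
    · rw [h, Nat.mul_mod_right] at hmod
      omega
  · have hjk : t % k + 1 = k := by have := Nat.mod_lt t hk; omega
    have ht1 : t + 1 = k * (t / k + 1) := by
      have := Nat.div_add_mod t k
      rw [mul_add]; omega
    have hdiv : (t + 1) / k = t / k + 1 := by rw [ht1, Nat.mul_div_cancel_left _ hk]
    have hmod : (t + 1) % k = 0 := by rw [ht1, Nat.mul_mod_right]
    have hact : (decide (v ∈ R) && !decide (∀ i < k, (nbUnion G (reach G R i) v).card ≤
        peelBound k d i)) = decide (v ∈ remaining G k d (t / k + 1)) := by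
      rw [← decide_not, ← Bool.decide_and, decide_eq_decide, mem_remaining_succ]
      rfl
    have hx' : x = ⟨ident v, t + 1, layer G k d (t / k + 1) v,
        decide (v ∈ remaining G k d (t / k + 1)), true,
        if t + 1 = k * m then {vertexKey L (layer G k d (t / k + 1) v) (ident v)}
          else if v ∈ remaining G k d (t / k + 1) then {ident v} else ∅⟩ := by
      rw [hx, layer_succ]
      simp only [peelStep, peelSpec, ht, hj, if_true, if_false, hUcard, ← hR, hok]
      simp only [hjk, hact, decide_eq_true_eq]
    refine ⟨fun h => ?_, fun h => ?_⟩
    · rw [hx', peelSpec]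
      simp only [hdiv, hmod, if_neg h.ne]
      by_cases hv : v ∈ remaining G k d (t / k + 1) <;> simp [reach, hv]
    · have hm : t / k + 1 = m := Nat.eq_of_mul_eq_mul_left hk (ht1.symm.trans h)
      rw [hx', hm, if_pos h]
      exact ⟨rfl, rfl, rfl, rfl⟩

theorem peelRun_eq_peelSpec (hinj : Function.Injective ident) (hk : 0 < k) {t : ℕ}
    (ht : t < k * m) (v : V) :
    peelRun G ident k d r m L t v = peelSpec G ident k d t v := by
  induction t generalizing v with
  | zero =>
    simp only [peelRun, setRun, peelInit, peelSpec, Nat.zero_div, Nat.zero_mod, layer, range_zero,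
      filter_empty, card_empty]
    simp [remaining, reach]
  | succ t ih =>
    rw [peelRun_succ]
    simp only [ih (by omega)]
    exact (peelStep_peelSpec G d r m L hinj hk (by omega) v).1 ht

theorem peelRun_end (hinj : Function.Injective ident) (hk : 0 < k) (hm : 0 < m) (v : V) :
    let x := peelRun G ident k d r m L (k * m) v
    x.id = ident v ∧ x.time = k * m ∧ x.lay = layer G k d m v ∧
      x.cur = {vertexKey L (layer G k d m v) (ident v)} := by
  intro x
  have hkm : 0 < k * m := Nat.mul_pos hk hm
  obtain ⟨t, ht⟩ : ∃ t, k * m = t + 1 := ⟨k * m - 1, by omega⟩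
  have hx : x = peelRun G ident k d r m L (t + 1) v := by rw [← ht]
  rw [hx, peelRun_succ, ht]
  simp only [peelRun_eq_peelSpec G d r m L hinj hk (show t < k * m by omega)]
  exact (peelStep_peelSpec G d r m L hinj hk (by omega) v).2 ht.symm

/-- The key of a vertex after the peeling part. -/
noncomputable def finalKey (ident : V → ℕ) (k : ℕ) (v : V) : ℕ :=
  vertexKey L (layer G k d m v) (ident v)

theorem peelRun_maxKey (hinj : Function.Injective ident) (hk : 0 < k) (hm : 0 < m) {i : ℕ}
    (hi : i ≤ r) (v : V) :
    let x := peelRun G ident k d r m L (k * m + i) v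
    x.id = ident v ∧ x.time = k * m + i ∧ x.lay = layer G k d m v ∧
      x.cur = {maxKey G (finalKey G d m L ident k) i v} := by
  induction i generalizing v with
  | zero => exact peelRun_end G d r m L hinj hk hm v
  | succ i ih =>
    obtain ⟨h1, h2, h3, h4⟩ := ih (by omega) v
    intro x
    have hx : x = peelStep k d r m L (peelRun G ident k d r m L (k * m + i) v)
        (nbUnion G (fun w => (peelRun G ident k d r m L (k * m + i) w).cur) v) := rfl
    simp only [fun w => (ih (by omega) w).2.2.2] at hx
    rw [peelStep, if_neg (by omega), if_pos (by omega), h1, h2, h3, h4] at hx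
    rw [hx]
    exact ⟨rfl, rfl, rfl, rfl⟩

theorem peelRun_spread (hinj : Function.Injective ident) (hk : 0 < k) (hm : 0 < m) (i : ℕ)
    (v : V) :
    let x := peelRun G ident k d r m L (k * m + r + i) v
    x.id = ident v ∧ x.time = k * m + r + i ∧ x.lay = layer G k d m v ∧
      x.cur = spread G (fun w => {maxKey G (finalKey G d m L ident k) r w}) i v := by
  induction i generalizing v with
  | zero => exact peelRun_maxKey G d r m L hinj hk hm le_rfl v
  | succ i ih =>
    obtain ⟨h1, h2, h3, h4⟩ := ih v
    intro x
    have hx : x = peelStep k d r m L (peelRun G ident k d r m L (k * m + r + i) v)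
        (nbUnion G (fun w => (peelRun G ident k d r m L (k * m + r + i) w).cur) v) := rfl
    simp only [fun w => (ih w).2.2.2] at hx
    rw [peelStep, if_neg (by omega), if_neg (by omega), h1, h2, h3, h4] at hx
    rw [hx]
    exact ⟨rfl, rfl, rfl, rfl⟩

end Run

/-! ### Size and order of the keys, message sizes, number of rounds -/

theorem vertexKey_lt {n lay i : ℕ} (hn : 2 ≤ n) (hlay : lay ≤ Nat.log 2 n + 1)
    (hi : i < 2 ^ Nat.clog 2 n) : vertexKey (Nat.clog 2 n) lay i < 2 ^ (3 * Nat.clog 2 n) := by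
  have h1 : Nat.log 2 n ≤ Nat.clog 2 n := Nat.log_le_clog 2 n
  have h2 : 0 < Nat.clog 2 n := Nat.clog_pos (by norm_num) hn
  generalize Nat.clog 2 n = L at *
  have h3 : L < 2 ^ L := Nat.lt_two_pow_self
  have h4 : 2 ^ (3 * L) = 2 ^ L * 2 ^ L * 2 ^ L := by ring
  rw [vertexKey, h4]
  generalize 2 ^ L = x at *
  -- The layer is at most `L + 1` and `L < x`, so `lay + 1 ≤ x + 1 ≤ x * x`, using `x ≥ 2`.
  have h5 : lay + 1 ≤ x * x := by nlinarith
  calc lay * x + i < lay * x + x := by omega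
    _ = (lay + 1) * x := by ring
    _ ≤ _ := Nat.mul_le_mul_right _ h5

theorem lay_le_of_vertexKey_le {L a b i j : ℕ} (hj : j < 2 ^ L)
    (h : vertexKey L a i ≤ vertexKey L b j) : a ≤ b := by
  by_contra hab
  rw [vertexKey, vertexKey] at h
  have : (b + 1) * 2 ^ L ≤ a * 2 ^ L := Nat.mul_le_mul_right _ (by omega)
  rw [add_mul] at this
  omega

/-- The number of phases of peeling. -/
def phases (n : ℕ) : ℕ := Nat.log 2 n + 1

/-- All messages of the algorithm are small sets of small numbers. -/
theorem peelRun_cur_bound {V : Type} [Fintype V] {G : SimpleGraph V} {ident : V → ℕ} {d r : ℕ}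
    (hr : 0 < r) (hn : 2 ≤ Fintype.card V) (hid : IsIdAssignment ident)
    (hrem : remaining G (2 * r) d (phases (Fintype.card V)) = ∅) {t : ℕ}
    (ht : t < 2 * r * phases (Fintype.card V) + 2 * r) (v : V) :
    (∀ a ∈ (peelRun G ident (2 * r) d r (phases (Fintype.card V)) (Nat.clog 2 (Fintype.card V))
      t v).cur, a < 2 ^ (3 * Nat.clog 2 (Fintype.card V))) ∧
    (peelRun G ident (2 * r) d r (phases (Fintype.card V)) (Nat.clog 2 (Fintype.card V))
      t v).cur.card ≤ reachBound (2 * r) d (2 * r) + weakBound (2 * r) d (2 * r) := by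
  classical
  set m := phases (Fintype.card V) with hm
  set L := Nat.clog 2 (Fintype.card V) with hL
  have hk : 0 < 2 * r := by omega
  have hm0 : 0 < m := Nat.succ_pos _
  have hkey : ∀ w, finalKey G d m L ident (2 * r) w < 2 ^ (3 * L) :=
    fun w => vertexKey_lt hn (layer_le _ _ _ _ _) (hid.2 w)
  have hlay : ∀ u w, finalKey G d m L ident (2 * r) u ≤ finalKey G d m L ident (2 * r) w →
      layer G (2 * r) d m u ≤ layer G (2 * r) d m w :=
    fun u w h => lay_le_of_vertexKey_le (hid.2 w) h
  have hweak := weakBound_pos (2 * r) d (2 * r)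
  rcases lt_or_ge t (2 * r * m) with h1 | h1
  · rw [peelRun_eq_peelSpec G d r m L hid.1 hk h1]
    have hmod := Nat.mod_lt t hk
    constructor
    · intro a ha
      obtain ⟨w, -, rfl⟩ := mem_image.1 ha
      exact (hid.2 w).trans_le (Nat.pow_le_pow_right (by norm_num) (by omega))
    · exact card_image_le.trans ((card_reach_remaining_le hk _ hmod.le v).trans
        ((reachBound_mono hk hmod.le).trans (Nat.le_add_right _ _)))
  · rcases lt_or_ge t (2 * r * m + r) with h2 | h2
    · obtain ⟨i, rfl⟩ := Nat.exists_eq_add_of_le h1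
      rw [(peelRun_maxKey G d r m L hid.1 hk hm0 (show i ≤ r by omega) v).2.2.2]
      obtain ⟨u, -, hu⟩ := exists_key_eq_maxKey G (finalKey G d m L ident (2 * r)) i v
      constructor
      · intro a ha
        rw [mem_singleton.1 ha, ← hu]
        exact hkey u
      · rw [card_singleton]; omega
    · obtain ⟨i, rfl⟩ := Nat.exists_eq_add_of_le h2
      rw [(peelRun_spread G d r m L hid.1 hk hm0 i v).2.2.2]
      have hsub := spread_maxKey_subset (G := G) hlay (show i ≤ r by omega) v
      constructor
      · intro a ha
        obtain ⟨u, -, rfl⟩ := mem_image.1 (hsub ha)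
        exact hkey u
      · exact (card_le_card hsub).trans (card_image_le.trans
          ((card_weakReach_le hrem le_rfl v).trans (Nat.le_add_left _ _)))

/-- The number of rounds of the algorithm. -/
def peelRounds (r n : ℕ) : ℕ := if n ≤ 1 then 0 else 2 * r * phases n + 2 * r

/-- The decision of a vertex at the end. -/
def peelOutput (r n : ℕ) (x : PeelState) : Bool :=
  decide (n ≤ 1 ∨ r = 0 ∨ vertexKey (Nat.clog 2 n) x.lay x.id ∈ x.cur)

theorem peelOutput_eq_true {r n : ℕ} {x : PeelState} : peelOutput r n x = true ↔
    n ≤ 1 ∨ r = 0 ∨ vertexKey (Nat.clog 2 n) x.lay x.id ∈ x.cur := by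
  rw [peelOutput, decide_eq_true_eq]

theorem peelRounds_le (r n : ℕ) :
    (peelRounds r n : ℝ) ≤ ((10 : ℕ) : ℝ) * ((r : ℝ) ^ 2 * Real.log (n : ℝ)) := by
  rw [peelRounds]
  split_ifs with hn
  · interval_cases n <;> simp
  · have h2 : (2 : ℝ) ≤ n := by exact_mod_cast (by omega : 2 ≤ n)
    have hlog2 := Real.log_two_gt_d9
    have hlog : Real.log 2 ≤ Real.log n := Real.log_le_log (by norm_num) h2
    have h3 : (Nat.log 2 n : ℝ) * Real.log 2 ≤ Real.log n := by
      rw [← Real.log_pow]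
      refine Real.log_le_log (by positivity) ?_
      exact_mod_cast Nat.pow_log_le_self 2 (by omega)
    -- Both `Nat.log 2 n * Real.log 2` and `Real.log 2` are at most `Real.log n`, and `3 / Real.log
    -- 2 < 5`.
    have h4 : (Nat.log 2 n : ℝ) + 2 ≤ 5 * Real.log n := by
      have : (0 : ℝ) ≤ Nat.log 2 n := Nat.cast_nonneg _
      nlinarith
    have h5 : (r : ℝ) ≤ (r : ℝ) ^ 2 := by
      exact_mod_cast Nat.le_self_pow (by norm_num) r
    have hr : (0 : ℝ) ≤ r := Nat.cast_nonneg _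
    rw [phases]
    push_cast
    calc 2 * (r : ℝ) * (Nat.log 2 n + 1) + 2 * r = 2 * (r * ((Nat.log 2 n : ℝ) + 2)) := by ring
      _ ≤ 2 * ((r : ℝ) ^ 2 * (5 * Real.log n)) := by gcongr
      _ = _ := by ring

theorem isApproxMinDistDominating_univ {V : Type} [Fintype V] {G : SimpleGraph V} {r c : ℕ}
    (hc : 0 < c) (h : Fintype.card V ≤ 1 ∨ r = 0) : IsApproxMinDistDominating G r c univ := by
  refine ⟨fun v => ⟨v, mem_univ _, by simp⟩, fun D' hD' => ?_⟩
  have hD : D' = univ := by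
    refine eq_univ_of_forall fun v => ?_
    obtain ⟨u, hu, huv⟩ := hD' v
    rcases h with h | rfl
    · exact Fintype.card_le_one_iff.1 h u v ▸ hu
    · have : u = v := by simpa using huv
      exact this ▸ hu
  rw [hD]
  exact Nat.le_mul_of_pos_left _ hc

end Algorithm

/-! ### Assembly -/

theorem mainTheorem3 :
    ∃ K : ℕ, ∀ C : GraphClass, BoundedExpansion C → ∀ r : ℕ,
      ∃ (c B : ℕ) (A : CongestBCAlgorithm B),
        (∀ n : ℕ, (A.rounds n : ℝ) ≤ (K : ℝ) * ((r : ℝ) ^ 2 * Real.log (n : ℝ))) ∧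
        ∀ (V : Type) [Fintype V] (G : SimpleGraph V), C V G →
          ∀ ident : V → ℕ, IsIdAssignment ident →
            IsApproxMinDistDominating G r c (A.outputSet G ident) := by
  classical
  refine ⟨10, fun C ⟨f, hf⟩ r => ?_⟩
  let k := 2 * r
  let d := f k
  -- The sum dominates the size of the messages of both the peeling and the flooding rounds.
  let M := reachBound k d k + weakBound k d k
  choose enc dec henc hdec using fun n : ℕ => exists_encoding M (Nat.clog 2 n)
  let A := setAlgorithm (fun _ i => peelInit i) PeelState.cur
    (fun n => peelStep k d r (phases n) (Nat.clog 2 n)) (peelRounds r) (peelOutput r) enc dec henc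
  refine ⟨weakBound k d k, 6 * M, A, peelRounds_le r, ?_⟩
  intro V _ G hCG ident hid
  have houtput : ∀ v, v ∈ A.outputSet G ident ↔ peelOutput r (Fintype.card V)
      (A.stateAfter G ident (peelRounds r (Fintype.card V)) v) = true := by
    intro v
    simp only [CongestBCAlgorithm.outputSet, Finset.mem_filter, Finset.mem_univ, true_and]
    rfl
  -- For `r = 0` the phases have no rounds, and for at most one vertex messages have no bits; in
  -- both cases the whole vertex set is the only dominating set.
  by_cases htriv : Fintype.card V ≤ 1 ∨ r = 0
  · have : A.outputSet G ident = Finset.univ := by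
      refine Finset.eq_univ_of_forall fun v => (houtput v).2 (peelOutput_eq_true.2 ?_)
      tauto
    rw [this]
    exact isApproxMinDistDominating_univ (weakBound_pos _ _ _) htriv
  rw [not_or] at htriv
  have hn : 2 ≤ Fintype.card V := by omega
  have hr : 0 < r := by omega
  have hk : 0 < k := by omega
  set m := phases (Fintype.card V) with hm
  set L := Nat.clog 2 (Fintype.card V) with hL
  have hG : ∀ (W : Type) [Finite W] (H : SimpleGraph W), IsShallowMinor k H G →
      averageDegree H ≤ d := fun W _ H h => hf k V G hCG W H h
  have hrem : remaining G k d m = ∅ :=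
    remaining_eq_empty hk hG (Nat.lt_pow_succ_log_self (by norm_num) _)
  have hT : peelRounds r (Fintype.card V) = k * m + r + r := by
    rw [peelRounds, if_neg htriv.1, ← hm, add_assoc, ← two_mul]
  have hrun : ∀ v, A.stateAfter G ident (k * m + r + r) v =
      peelRun G ident k d r m L (k * m + r + r) v := by
    refine stateAfter_setAlgorithm (T := k * m + r + r) (fun t ht v => ?_) _ le_rfl
    have h := peelRun_cur_bound (G := G) hr hn hid hrem (t := t)
      (ht.trans_eq (by rw [add_assoc, ← two_mul])) v
    exact hdec _ (Nat.clog_pos (by norm_num) hn) _ h.1 h.2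
  have hset : A.outputSet G ident = Finset.univ.filter fun v => finalKey G d m L ident k v ∈
      spread G (fun w => {maxKey G (finalKey G d m L ident k) r w}) r v := by
    ext v
    obtain ⟨h1, -, h3, h4⟩ := peelRun_spread G d r m L hid.1 hk (Nat.succ_pos _) r v
    rw [houtput, hT, hrun, peelOutput_eq_true, h1, h3, h4]
    simp [htriv.1, htriv.2, finalKey, hL]
  have hlay : ∀ u w, finalKey G d m L ident k u ≤ finalKey G d m L ident k w →
      layer G k d m u ≤ layer G k d m w := fun u w h => lay_le_of_vertexKey_le (hid.2 w) h
  have hinj : Function.Injective (finalKey G d m L ident k) := by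
    intro u w h
    have hl := le_antisymm (hlay u w h.le) (hlay w u h.ge)
    simp only [finalKey, vertexKey, hl] at h
    exact hid.1 (by omega)
  rw [hset]
  exact isApprox_filter_mem_spread hinj hlay fun v => card_weakReach_le hrem le_rfl v
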